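/- Let $N\in\mathbb N$ and let $g:\mathbb R^N\to(-\infty,+\infty]$ satisfy: (H1) $g$ is bounded from below, lower semicontinuous and in $L^1_{\rm loc}(\mathbb R^N)$; (H2) $\liminf_{|x|\to\infty} g(x)\ge 0$; (H4) there is a Borel probability measure $\mu_0\in\mathcal P(\mathbb R^N)$ with $\mathcal E(\mu_0)<0$, where $$\mathcal E(\mu)=\iint g(x-y)\,d\mu(x)\,d\mu(y)\in(-\infty,+\infty],\qquad \mu\in\mathcal P(\mathbb R^N).$$ For $n\ge 1$ and $\mu\in\mathcal P(\mathbb R^N)$ put $$\mathcal E_n(\mu)=\frac1{n^2}\sum_{1\le i\ne j\le n} g(x_i-x_j)\quad\text{if }\mu=\frac1n\sum_{i=1}^n\delta_{x_i}\text{ for some }x_1,\dots,x_n\in\mathbb R^N,$$ and $\mathcal E_n(\mu)=+\infty$ otherwise. Let $m_n=\inf_{\mathcal P(\mathbb R^N)}\mathcal E_n$ and $\ell_P=\liminf_{n\to\infty}m_n$. Then $$\ell_P=\lim_{n\to\infty}m_n=\inf\{\mathcal E(\mu):\mu\in\mathcal P(\mathbb R^N)\}.$$ Moreover, let $(n_k)$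 be a strictly increasing sequence of natural numbers (for instance $n_k=k$) and let $\pi_k\in\mathcal P(\mathbb R^N)$ be such that $\mathcal E_{n_k}(\pi_k)\to\ell_P$ as $k\to\infty$. Then $(\pi_k)$ is precompact in $\mathcal P(\mathbb R^N)$ up to translations: there are $a_k\in\mathbb R^N$ such that every subsequence of the translated measures $(\cdot+a_k)_\#\pi_k$ has a further subsequence converging weakly-$*$ (that is, tested against every continuous compactly supported function) to some element of $\mathcal P(\mathbb R^N)$. Furthermore, for every choice of translation vectors $a_k\in\mathbb R^N$, each $\mu\in\mathcal P(\mathbb R^N)$ that is the weak-$*$ limit of a subsequence of $(\cdot+a_k)_\#\pi_k$ is a minimizer of $\mathcal E$ over $\mathcal P(\mathbb R^N)$. -/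

import Mathlib

open MeasureTheory Filter Topology
open scoped ENNReal

/-- `ℝ^N` with its Euclidean norm. -/
abbrev RN (N : ℕ) : Type := EuclideanSpace ℝ (Fin N)

/-- Lebesgue integral `∫ f⁺ dμ - ∫ f⁻ dμ` of an extended real valued function. It is only used for
measurable functions that are bounded from below, against probability measures, so that the
subtracted term is finite. -/
noncomputable def extIntegral {α : Type*} [MeasurableSpace α] (μ : Measure α) (f : α → EReal) :
    EReal :=
  ((∫⁻ x, (f x).toENNReal ∂μ : ℝ≥0∞) : EReal) - ((∫⁻ x, (-f x).toENNReal ∂μ : ℝ≥0∞) : EReal)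

/-- The continuum energy `𝓔(μ) = ∬ g(x - y) dμ(x) dμ(y)`. -/
noncomputable def energy {N : ℕ} (g : RN N → EReal) (μ : ProbabilityMeasure (RN N)) : EReal :=
  extIntegral ((μ : Measure (RN N)).prod (μ : Measure (RN N))) (fun p => g (p.1 - p.2))

/-- The `n`-particle energy `𝓔ₙ(x₁, …, xₙ) = (1 / n²) ∑_{i ≠ j} g(xᵢ - xⱼ)`. -/
noncomputable def particleEnergy {N : ℕ} (g : RN N → EReal) {n : ℕ} (x : Fin n → RN N) : EReal :=
  ((1 / (n : ℝ) ^ 2 : ℝ) : EReal) *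
    ∑ p ∈ (Finset.univ : Finset (Fin n)).offDiag, g (x p.1 - x p.2)

/-- The atomic measure `(1 / n) ∑ᵢ δ_{xᵢ}`. -/
noncomputable def empiricalMeasure {N n : ℕ} (x : Fin n → RN N) : Measure (RN N) :=
  (n : ℝ≥0∞)⁻¹ • ∑ i, Measure.dirac (x i)

/-- The discrete energy `𝓔ₙ` extended to all probability measures: `𝓔ₙ(x₁, …, xₙ)` if
`μ = (1 / n) ∑ᵢ δ_{xᵢ}`, and `+∞` if `μ` is not `n`-discrete. The points of an `n`-discrete measure
are determined up to a permutation, which does not change the `n`-particle energy, so the infimum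
below runs over a single value, or over the empty set. -/
noncomputable def discreteEnergy {N : ℕ} (g : RN N → EReal) (n : ℕ)
    (μ : ProbabilityMeasure (RN N)) : EReal :=
  ⨅ (x : Fin n → RN N) (_ : (μ : Measure (RN N)) = empiricalMeasure x), particleEnergy g x

/-- The discrete ground state energy `mₙ = inf 𝓔ₙ`. -/
noncomputable def groundEnergy {N : ℕ} (g : RN N → EReal) (n : ℕ) : EReal :=
  ⨅ μ : ProbabilityMeasure (RN N), discreteEnergy g n μ

/-- `μ` minimizes the continuum energy among all probability measures. -/
def IsEnergyMinimizer {N : ℕ} (g : RN N → EReal) (μ : ProbabilityMeasure (RN N)) : Prop :=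
  ∀ ν : ProbabilityMeasure (RN N), energy g μ ≤ energy g ν

/-- Weak-* convergence of probability measures: convergence of the integrals of all continuous
functions with compact support. -/
def WeakStarTendsto {N : ℕ} (ν : ℕ → ProbabilityMeasure (RN N)) (μ : ProbabilityMeasure (RN N)) :
    Prop :=
  ∀ f : RN N → ℝ, Continuous f → HasCompactSupport f →
    Tendsto (fun k => ∫ x, f x ∂(ν k : Measure (RN N))) atTop (𝓝 (∫ x, f x ∂(μ : Measure (RN N))))

/-- The translate of `μ` by the vector `a`: the image of `μ` under `x ↦ x + a`. -/
noncomputable def translateMeasure {N : ℕ} (a : RN N) (μ : ProbabilityMeasure (RN N)) :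
    ProbabilityMeasure (RN N) :=
  μ.map (f := fun x => x + a) (measurable_add_const a).aemeasurable

/-- The sequence `ν` is precompact in the space of probability measures with respect to weak-*
convergence: every subsequence has a further subsequence that converges weakly-* to a probability
measure. -/
def WeakStarPrecompact {N : ℕ} (ν : ℕ → ProbabilityMeasure (RN N)) : Prop :=
  ∀ φ : ℕ → ℕ, StrictMono φ → ∃ ψ : ℕ → ℕ, StrictMono ψ ∧
    ∃ μ : ProbabilityMeasure (RN N), WeakStarTendsto (fun k => ν (φ (ψ k))) μ

/-- `μ` is a weak-* limit point of the sequence `ν`: some subsequence converges to it. -/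
def IsWeakStarLimitPoint {N : ℕ} (ν : ℕ → ProbabilityMeasure (RN N))
    (μ : ProbabilityMeasure (RN N)) : Prop :=
  ∃ φ : ℕ → ℕ, StrictMono φ ∧ WeakStarTendsto (fun k => ν (φ k)) μ

/-!
The proof replaces `g` by its truncations `trunc g M = min g M`, which are bounded lower
semicontinuous real kernels. Let `I M` be the infimum of the truncated energy and `J = sup_M I M`;
then `J ≤ inf 𝓔 < 0`. A sequence of probability measures is asymptotically minimizing if, for every
`M`, its truncated energies are eventually at most `J + ε`.

*Compactness* (`exists_ball_of_asymptotically_minimizing`). Negative energy forces a ball of fixed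
radius to carry a fixed amount `δ` of mass (`exists_le_measureReal_ball`). Around this ball, some
annulus of width `L` out of `n` disjoint ones carries mass at most `1 / n`. Cutting there splits the
measure into an inner part of mass `s ≥ δ` and an outer part of mass at most `1 - s`; their
interaction is almost nonnegative, so the energy is at least `(s² + (1 - s)²) I M` up to a small
error, because the energy is quadratic in the measure (`exists_ball_split`). As `I M → J < 0`, this
forces `s` close to `1`. Hence the sequence is tight up to translations, and Prokhorov's theorem
applies.

*Limits* (`energy_le_of_isWeakStarLimitPoint`). A weak-* limit that is a probability measure is a
weak limit, and the truncated energies are weakly lower semicontinuous, so the limit `μ` satisfies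
`𝓔 μ ≤ J` by monotone convergence in `M`. Applied to almost minimizers of the truncated problems this
gives `inf 𝓔 = J`, and the infimum is attained (`exists_energy_eq_iInf`).

*Discrete energies.* Truncation bounds the self-interaction of the atoms: the truncated energy of an
`n`-atomic measure is at most its `n`-particle energy plus `M / n`
(`kernelEnergy_trunc_sub_le_discreteEnergy`). So `liminf mₙ ≥ J`, and discrete measures whose
energies tend to `J` are asymptotically minimizing. Conversely, `n` independent points with law `μ`
have mean `n`-particle energy `(1 - 1 / n) 𝓔 μ`, so `mₙ ≤ (1 - 1 / n) inf 𝓔` (`groundEnergy_le`).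
-/

variable {N : ℕ}

/-! ### Real kernels and truncations -/

/-- The interaction energy `∬ f (x - y) dμ(x) dμ(y)` of a real valued kernel `f`, as a Bochner
integral. It is used for bounded measurable `f` only, so the integrand is integrable against every
finite measure. -/
noncomputable def kernelEnergy {N : ℕ} (f : RN N → ℝ) (μ : Measure (RN N)) : ℝ :=
  ∫ p, f (p.1 - p.2) ∂(μ.prod μ)

/-- The truncated kernel `min g M` as a real valued function. When `g` is bounded from below by a real
number, `toReal` acts on finite values only, see `coe_trunc`. -/
noncomputable def trunc {N : ℕ} (g : RN N → EReal) (M : ℕ) (x : RN N) : ℝ :=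
  (min (g x) ((M : ℝ) : EReal)).toReal

theorem coe_trunc {g : RN N → EReal} {c : ℝ} (hg : ∀ x, (c : EReal) ≤ g x) (M : ℕ) (x : RN N) :
    (trunc g M x : EReal) = min (g x) ((M : ℝ) : EReal) := by
  refine EReal.coe_toReal ?_ ?_
  · exact ne_of_lt ((min_le_right _ _).trans_lt (EReal.coe_lt_top _))
  · refine ne_of_gt (lt_of_lt_of_le (EReal.bot_lt_coe (min c M)) (le_min ?_ ?_))
    · exact le_trans (by exact_mod_cast min_le_left _ _) (hg x)
    · exact_mod_cast min_le_right _ _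

theorem trunc_le {g : RN N → EReal} {c : ℝ} (hg : ∀ x, (c : EReal) ≤ g x) (M : ℕ) (x : RN N) :
    trunc g M x ≤ M := by
  rw [← EReal.coe_le_coe_iff, coe_trunc hg]
  exact min_le_right _ _

theorem coe_trunc_le {g : RN N → EReal} {c : ℝ} (hg : ∀ x, (c : EReal) ≤ g x) (M : ℕ) (x : RN N) :
    (trunc g M x : EReal) ≤ g x := by
  rw [coe_trunc hg]
  exact min_le_left _ _

theorem le_trunc {g : RN N → EReal} {c : ℝ} (hg : ∀ x, (c : EReal) ≤ g x) {a : ℝ} (ha : a ≤ 0)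
    (M : ℕ) {x : RN N} (hx : (a : EReal) ≤ g x) : a ≤ trunc g M x := by
  rw [← EReal.coe_le_coe_iff, coe_trunc hg]
  refine le_min hx ?_
  exact_mod_cast ha.trans M.cast_nonneg

theorem trunc_mono {g : RN N → EReal} {c : ℝ} (hg : ∀ x, (c : EReal) ≤ g x) {M M' : ℕ}
    (h : M ≤ M') (x : RN N) : trunc g M x ≤ trunc g M' x := by
  rw [← EReal.coe_le_coe_iff, coe_trunc hg, coe_trunc hg]
  exact min_le_min le_rfl (by exact_mod_cast h)

theorem lowerSemicontinuous_trunc {g : RN N → EReal} {c : ℝ} (hg : ∀ x, (c : EReal) ≤ g x)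
    (hlsc : LowerSemicontinuous g) (M : ℕ) : LowerSemicontinuous (trunc g M) := by
  intro x y hy
  have h : LowerSemicontinuous (fun x => min (g x) ((M : ℝ) : EReal)) :=
    hlsc.inf lowerSemicontinuous_const
  have hy' : (y : EReal) < min (g x) ((M : ℝ) : EReal) := by
    rw [← coe_trunc hg]; exact_mod_cast hy
  filter_upwards [h x y hy'] with z hz
  rw [← coe_trunc hg] at hz
  exact_mod_cast hz

/-! ### Energy splitting and concentration of mass -/

section kernel

variable {f : RN N → ℝ} {a b : ℝ}

theorem integrable_of_bounds {α : Type*} [MeasurableSpace α] {f : α → ℝ} (hf : Measurable f)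
    (ha : ∀ x, a ≤ f x) (hb : ∀ x, f x ≤ b) (μ : Measure α) [IsFiniteMeasure μ] :
    Integrable f μ := by
  refine Integrable.of_bound hf.aestronglyMeasurable (max |a| |b|) (ae_of_all _ fun x => ?_)
  exact abs_le_max_abs_abs (ha x) (hb x)

theorem integrable_kernel (hf : Measurable f) (ha : ∀ x, a ≤ f x) (hb : ∀ x, f x ≤ b)
    (μ : Measure (RN N × RN N)) [IsFiniteMeasure μ] :
    Integrable (fun p : RN N × RN N => f (p.1 - p.2)) μ :=
  integrable_of_bounds (hf.comp (measurable_fst.sub measurable_snd)) (fun _ => ha _)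
    (fun _ => hb _) _

theorem le_kernelEnergy (hf : Measurable f) (ha : ∀ x, a ≤ f x) (hb : ∀ x, f x ≤ b)
    (μ : Measure (RN N)) [IsProbabilityMeasure μ] : a ≤ kernelEnergy f μ := by
  have := integral_mono (integrable_const a) (integrable_kernel hf ha hb (μ.prod μ))
    (fun p => ha _)
  simpa [kernelEnergy] using this

theorem kernelEnergy_mono {f' : RN N → ℝ} {a' b' : ℝ} (hf : Measurable f) (ha : ∀ x, a ≤ f x)
    (hb : ∀ x, f x ≤ b) (hf' : Measurable f') (ha' : ∀ x, a' ≤ f' x) (hb' : ∀ x, f' x ≤ b')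
    (h : ∀ x, f x ≤ f' x) (μ : Measure (RN N)) [IsProbabilityMeasure μ] :
    kernelEnergy f μ ≤ kernelEnergy f' μ :=
  integral_mono (integrable_kernel hf ha hb _) (integrable_kernel hf' ha' hb' _) fun _ => h _

theorem kernelEnergy_map_add (hf : Measurable f) (μ : Measure (RN N)) [IsProbabilityMeasure μ]
    (v : RN N) : kernelEnergy f (μ.map (fun x => x + v)) = kernelEnergy f μ := by
  have hm : Measurable (fun x : RN N => x + v) := measurable_add_const v
  rw [kernelEnergy, Measure.map_prod_map _ _ hm hm, integral_map]
  · simp [kernelEnergy]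
  · exact (hm.prodMap hm).aemeasurable
  · exact (hf.comp (measurable_fst.sub measurable_snd)).aestronglyMeasurable

/-- The energy is quadratic in the measure: the self-energy of the restriction of `μ` to `A` is
`μ(A)²` times the energy of the conditional probability measure. -/
theorem sq_mul_le_setIntegral {i : ℝ}
    (hi : ∀ ν : ProbabilityMeasure (RN N), i ≤ kernelEnergy f ν)
    (μ : Measure (RN N)) [IsProbabilityMeasure μ] (A : Set (RN N)) :
    μ.real A ^ 2 * i ≤ ∫ p in A ×ˢ A, f (p.1 - p.2) ∂(μ.prod μ) := by
  rcases eq_or_ne (μ A) 0 with h0 | h0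
  · have : (μ.prod μ) (A ×ˢ A) = 0 := by simp [h0]
    rw [Measure.restrict_eq_zero.2 this]
    simp [Measure.real, h0]
  have hp : IsProbabilityMeasure (ProbabilityTheory.cond μ A) :=
    ProbabilityTheory.cond_isProbabilityMeasure h0
  have hr : μ.restrict A = μ A • ProbabilityTheory.cond μ A := by
    rw [ProbabilityTheory.cond, smul_smul, ENNReal.mul_inv_cancel h0 (measure_ne_top _ _),
      one_smul]
  have h := hi ⟨ProbabilityTheory.cond μ A, hp⟩
  rw [← Measure.prod_restrict, hr, Measure.prod_smul_left, Measure.prod_smul_right, smul_smul,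
    integral_smul_measure]
  have : (μ A * μ A).toReal = μ.real A ^ 2 := by rw [ENNReal.toReal_mul, sq]; rfl
  rw [this, smul_eq_mul]
  exact mul_le_mul_of_nonneg_left h (sq_nonneg _)

/-- Lower bound for the energy of a measure split into two parts, carried by sets `A` and `B` at
distance at least `L`, and a remainder. The cross terms cost at most `ε` since `f ≥ -ε` at distance
`L`, the terms involving the remainder at most `2 C` times its mass. -/
theorem split_le_kernelEnergy (hf : Measurable f) {C ε L i : ℝ} (hC : 0 ≤ C) (hε : 0 ≤ ε)
    (ha : ∀ x, -C ≤ f x) (hb : ∀ x, f x ≤ b) (hL : ∀ x, L ≤ ‖x‖ → -ε ≤ f x)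
    (hi : ∀ ν : ProbabilityMeasure (RN N), i ≤ kernelEnergy f ν)
    (μ : Measure (RN N)) [IsProbabilityMeasure μ] {A B : Set (RN N)} (hA : MeasurableSet A)
    (hB : MeasurableSet B) (hAB : ∀ x ∈ A, ∀ y ∈ B, L ≤ ‖x - y‖) (hd : Disjoint A B) :
    i * (μ.real A ^ 2 + μ.real B ^ 2) - ε - 2 * C * μ.real (A ∪ B)ᶜ ≤ kernelEnergy f μ := by
  classical
  set D := (A ∪ B)ᶜ with hD
  have hDm : MeasurableSet D := (hA.union hB).compl
  set F : RN N × RN N → ℝ := fun p => f (p.1 - p.2) with hF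
  have hFi : Integrable F (μ.prod μ) := integrable_kernel hf ha hb _
  have h1 : Integrable ((A ×ˢ A).indicator F) (μ.prod μ) := hFi.indicator (hA.prod hA)
  have h2 : Integrable ((B ×ˢ B).indicator F) (μ.prod μ) := hFi.indicator (hB.prod hB)
  have h3 : Integrable (fun p : RN N × RN N => D.indicator (fun _ => C) p.1) (μ.prod μ) :=
    ((integrable_const C).indicator hDm).comp_fst μ
  have h4 : Integrable (fun p : RN N × RN N => D.indicator (fun _ => C) p.2) (μ.prod μ) :=
    ((integrable_const C).indicator hDm).comp_snd μ
  -- pointwise bound, integrated below; each of the nine positions of `p` is a linear inequality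
  have key : ∀ p : RN N × RN N, (A ×ˢ A).indicator F p + (B ×ˢ B).indicator F p - ε
      - D.indicator (fun _ => C) p.1 - D.indicator (fun _ => C) p.2 ≤ F p := by
    rintro ⟨x, y⟩
    have hxy := ha (x - y)
    have hAB' : x ∈ A → y ∈ B → -ε ≤ f (x - y) := fun hx hy => hL _ (hAB x hx y hy)
    have hBA' : x ∈ B → y ∈ A → -ε ≤ f (x - y) := fun hx hy => hL _ (by
      rw [norm_sub_rev]; exact hAB y hy x hx)
    have hdx : x ∈ A → x ∉ B := fun h h' => Set.disjoint_left.1 hd h h'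
    have hdy : y ∈ A → y ∉ B := fun h h' => Set.disjoint_left.1 hd h h'
    by_cases hxA : x ∈ A <;> by_cases hxB : x ∈ B <;> by_cases hyA : y ∈ A <;>
      by_cases hyB : y ∈ B <;>
      simp [Set.indicator, hD, hF, hxA, hxB, hyA, hyB] at hAB' hBA' hdx hdy ⊢ <;> linarith
  have hint := integral_mono ((((h1.add h2).sub (integrable_const ε)).sub h3).sub h4) hFi key
  have e : ∫ p, ((A ×ˢ A).indicator F + (B ×ˢ B).indicator F - (fun _ => ε)
      - (fun p => D.indicator (fun _ => C) p.1)
      - (fun p => D.indicator (fun _ => C) p.2) : RN N × RN N → ℝ) p ∂(μ.prod μ)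
      = ∫ p in A ×ˢ A, F p ∂(μ.prod μ) + ∫ p in B ×ˢ B, F p ∂(μ.prod μ) - ε
        - C * μ.real D - C * μ.real D := by
    rw [integral_sub' (((h1.add h2).sub (integrable_const ε)).sub h3) h4,
      integral_sub' ((h1.add h2).sub (integrable_const ε)) h3,
      integral_sub' (h1.add h2) (integrable_const ε), integral_add' h1 h2,
      integral_indicator (hA.prod hA), integral_indicator (hB.prod hB),
      integral_fun_fst (f := D.indicator (fun _ => C)),
      integral_fun_snd (f := D.indicator (fun _ => C)), integral_indicator_const _ hDm]
    simp [mul_comm]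
  rw [e] at hint
  have hA' := sq_mul_le_setIntegral hi μ A
  have hB' := sq_mul_le_setIntegral hi μ B
  have : kernelEnergy f μ = ∫ p, F p ∂(μ.prod μ) := rfl
  rw [this]
  linarith

/-- Nonvanishing: if no ball of radius `R` carried mass `δ`, then the pairs at distance less than `R`,
the only ones with interaction below `-ε`, would contribute at least `-C δ`. -/
theorem exists_le_measureReal_ball (hf : Measurable f) {C ε R δ : ℝ} (hC : 0 ≤ C) (hε : 0 ≤ ε)
    (ha : ∀ x, -C ≤ f x) (hb : ∀ x, f x ≤ b) (hR : ∀ x, R ≤ ‖x‖ → -ε ≤ f x)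
    (μ : Measure (RN N)) [IsProbabilityMeasure μ] (hμ : kernelEnergy f μ < -ε - C * δ) :
    ∃ x, δ ≤ μ.real (Metric.ball x R) := by
  by_contra! h
  refine hμ.not_ge ?_
  have hS : MeasurableSet {p : RN N × RN N | dist p.1 p.2 < R} :=
    measurableSet_lt (measurable_fst.dist measurable_snd) measurable_const
  set S := {p : RN N × RN N | dist p.1 p.2 < R}
  have hSI : Integrable (S.indicator (fun _ => C)) (μ.prod μ) := (integrable_const C).indicator hS
  have key : ∀ p : RN N × RN N, -ε - S.indicator (fun _ => C) p ≤ f (p.1 - p.2) := by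
    intro p
    by_cases hp : p ∈ S
    · have := ha (p.1 - p.2)
      simp [hp]; linarith
    · have := hR (p.1 - p.2) (by rw [← dist_eq_norm]; exact not_lt.1 hp)
      simpa [hp] using this
  have hint := integral_mono ((integrable_const (-ε)).sub hSI)
    (integrable_kernel hf ha hb (μ.prod μ)) key
  rw [integral_sub' (integrable_const _) hSI, integral_indicator_const _ hS] at hint
  have hS' : (μ.prod μ).real S ≤ δ := by
    have h0 : 0 ≤ δ := measureReal_nonneg.trans (h 0).le
    refine ENNReal.toReal_le_of_le_ofReal h0 ?_
    rw [Measure.prod_apply hS]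
    calc ∫⁻ x, μ (Prod.mk x ⁻¹' S) ∂μ ≤ ∫⁻ _, ENNReal.ofReal δ ∂μ := by
          refine lintegral_mono fun x => ?_
          have : Prod.mk x ⁻¹' S = Metric.ball x R := by
            ext y; simp [S, dist_comm]
          rw [this, ← ofReal_measureReal]
          exact ENNReal.ofReal_le_ofReal (h x).le
      _ = _ := by simp
  have e : kernelEnergy f μ = ∫ p, f (p.1 - p.2) ∂(μ.prod μ) := rfl
  have := mul_le_mul_of_nonneg_left hS' hC
  simp at hint
  rw [e]
  linarith

/-- Of the `n` disjoint annuli of width `L` around `ball x R` one has mass at most `1 / n`. Splitting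
the measure along this annulus bounds the energy from below by that of two distant parts, of masses
`s` and at most `1 - s`. -/
theorem exists_ball_split (hf : Measurable f) {C ε L i δ R : ℝ} (hC : 0 ≤ C) (hε : 0 ≤ ε)
    (hLn : 0 ≤ L) (hi0 : i ≤ 0)
    (ha : ∀ x, -C ≤ f x) (hb : ∀ x, f x ≤ b) (hL : ∀ x, L ≤ ‖x‖ → -ε ≤ f x)
    (hi : ∀ ν : ProbabilityMeasure (RN N), i ≤ kernelEnergy f ν)
    (μ : Measure (RN N)) [IsProbabilityMeasure μ] {x : RN N}
    (hx : δ ≤ μ.real (Metric.ball x R)) {n : ℕ} (hn : 0 < n) :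
    ∃ s, δ ≤ s ∧ s ≤ μ.real (Metric.ball x (R + n * L)) ∧
      i * (s ^ 2 + (1 - s) ^ 2) - ε - 2 * C / n ≤ kernelEnergy f μ := by
  have hn' : (0 : ℝ) < n := by exact_mod_cast hn
  set m : ℕ → ℝ := fun j => μ.real (Metric.ball x (R + j * L)) with hm
  have hmono : ∀ {j k : ℕ}, j ≤ k → m j ≤ m k := fun {j k} h => by
    refine measureReal_mono (Metric.ball_subset_ball ?_)
    gcongr
  obtain ⟨j, hj, hj'⟩ : ∃ j ∈ Finset.range n, m (j + 1) - m j ≤ 1 / n := by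
    refine Finset.exists_le_of_sum_le (Finset.nonempty_range_iff.2 hn.ne') ?_
    rw [Finset.sum_range_sub]
    have h1 : m n ≤ 1 := measureReal_le_one
    have h2 : 0 ≤ m 0 := measureReal_nonneg
    simp only [Finset.sum_const, Finset.card_range, nsmul_eq_mul]
    rw [mul_one_div_cancel hn'.ne']
    linarith
  have hjn := Finset.mem_range.1 hj
  refine ⟨m j, ?_, hmono hjn.le, ?_⟩
  · refine hx.trans ?_
    have := hmono (Nat.zero_le j)
    simpa [hm] using this
  set A := Metric.ball x (R + j * L) with hA
  set B := (Metric.ball x (R + (j + 1 : ℕ) * L))ᶜ with hB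
  have hBm : MeasurableSet B := Metric.isOpen_ball.measurableSet.compl
  have hAB : A ⊆ Metric.ball x (R + (j + 1 : ℕ) * L) :=
    Metric.ball_subset_ball (by gcongr; omega)
  have hd : Disjoint A B := by
    rw [hB]
    exact Set.disjoint_compl_right_iff_subset.2 hAB
  have h := split_le_kernelEnergy hf hC hε ha hb hL hi μ (A := A) (B := B)
    Metric.isOpen_ball.measurableSet hBm (fun y hy z hz => by
      have h1 : dist y x < R + j * L := hy
      have h2 : R + (j + 1 : ℕ) * L ≤ dist z x := not_lt.1 hz
      have h3 := dist_triangle_left z x y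
      rw [← dist_eq_norm]
      push_cast at h2
      linarith) hd
  have hBr : μ.real B = 1 - m (j + 1) :=
    probReal_compl_eq_one_sub Metric.isOpen_ball.measurableSet
  have hDr : μ.real (A ∪ B)ᶜ = m (j + 1) - m j := by
    rw [probReal_compl_eq_one_sub (Metric.isOpen_ball.measurableSet.union hBm),
      measureReal_union hd hBm, hBr]
    ring
  have hAr : μ.real A = m j := rfl
  rw [hDr, hBr, hAr] at h
  have h1 : m (j + 1) ≤ 1 := measureReal_le_one
  have h2 := hmono (Nat.le_succ j)
  have h3 : (1 - m (j + 1)) ^ 2 ≤ (1 - m j) ^ 2 := by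
    apply pow_le_pow_left₀ <;> linarith
  have h4 := mul_le_mul_of_nonpos_left h3 hi0
  have h5 := mul_le_mul_of_nonneg_left hj' hC
  have h6 : 2 * C / n = 2 * (C * (1 / n)) := by ring
  rw [h6]
  linarith

end kernel

/-! ### Weak convergence and lower semicontinuity -/

/-- The superlevel sets of `f` are open, so the layer cake formula and Fatou's lemma reduce the claim
to the hypothesis on open sets. -/
theorem lintegral_le_liminf_of_lowerSemicontinuous {X : Type*} [MeasurableSpace X]
    [TopologicalSpace X] [OpensMeasurableSpace X] {μ : Measure X} {μs : ℕ → Measure X}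
    {f : X → ℝ} (hf : LowerSemicontinuous f) (h0 : 0 ≤ f)
    (h : ∀ G, IsOpen G → μ G ≤ liminf (fun k => μs k G) atTop) :
    ∫⁻ x, ENNReal.ofReal (f x) ∂μ ≤ liminf (fun k => ∫⁻ x, ENNReal.ofReal (f x) ∂(μs k)) atTop := by
  simp_rw [lintegral_eq_lintegral_meas_lt _ (Eventually.of_forall h0) hf.measurable.aemeasurable]
  refine (lintegral_mono fun t => h _ (hf.isOpen_preimage t)).trans ?_
  exact lintegral_liminf_le fun n => Antitone.measurable fun s t hst =>
    measure_mono fun ω hω => lt_of_le_of_lt hst hω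

theorem ofReal_kernelEnergy_add {f : RN N → ℝ} {C b : ℝ} (hf : Measurable f)
    (ha : ∀ x, -C ≤ f x) (hb : ∀ x, f x ≤ b) (μ : ProbabilityMeasure (RN N)) :
    ENNReal.ofReal (kernelEnergy f μ + C)
      = ∫⁻ p, ENNReal.ofReal (f (p.1 - p.2) + C) ∂((μ : Measure (RN N)).prod μ) := by
  have hi := integrable_kernel hf ha hb ((μ : Measure (RN N)).prod μ)
  have h := ofReal_integral_eq_lintegral_ofReal (hi.add (integrable_const C))
    (ae_of_all _ fun p => by have := ha (p.1 - p.2); show 0 ≤ f (p.1 - p.2) + C; linarith)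
  rw [integral_add' hi (integrable_const C)] at h
  simpa [kernelEnergy] using h

theorem kernelEnergy_le_of_tendsto {f : RN N → ℝ} {C b J : ℝ} (hf : LowerSemicontinuous f)
    (ha : ∀ x, -C ≤ f x) (hb : ∀ x, f x ≤ b) {μs : ℕ → ProbabilityMeasure (RN N)}
    {μ : ProbabilityMeasure (RN N)} (hμ : Tendsto μs atTop (𝓝 μ))
    (hJ : ∀ ε > 0, ∀ᶠ k in atTop, kernelEnergy f (μs k) ≤ J + ε) : kernelEnergy f μ ≤ J := by
  have hfm := hf.measurable
  refine le_of_forall_pos_le_add fun ε hε => ?_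
  have hp : Tendsto (fun k => (μs k).prod (μs k)) atTop (𝓝 (μ.prod μ)) :=
    (ProbabilityMeasure.continuous_prod.tendsto (μ, μ)).comp (hμ.prodMk_nhds hμ)
  have hlsc : LowerSemicontinuous fun p : RN N × RN N => f (p.1 - p.2) + C :=
    (hf.comp (continuous_fst.sub continuous_snd)).add lowerSemicontinuous_const
  have h := lintegral_le_liminf_of_lowerSemicontinuous hlsc
    (fun p => by have := ha (p.1 - p.2); show 0 ≤ f (p.1 - p.2) + C; linarith)
    (fun G hG => ProbabilityMeasure.le_liminf_measure_open_of_tendsto hp hG)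
  simp only [ProbabilityMeasure.toMeasure_prod, ← ofReal_kernelEnergy_add hfm ha hb] at h
  obtain ⟨k, hk⟩ := (hJ ε hε).exists
  have h0 : -C ≤ kernelEnergy f (μs k) := le_kernelEnergy hfm ha hb _
  have h2 : ENNReal.ofReal (kernelEnergy f μ + C) ≤ ENNReal.ofReal (J + ε + C) := by
    refine h.trans (liminf_le_of_frequently_le' ?_)
    refine ((hJ ε hε).mono fun k hk => ENNReal.ofReal_le_ofReal ?_).frequently
    linarith
  rw [ENNReal.ofReal_le_ofReal_iff (by linarith)] at h2
  linarith

/-- No mass is lost in a weak-* limit that is itself a probability measure. By the portmanteau theorem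
it suffices to bound `μ G` for open `G`, which is approximated from inside by compactly supported
functions. -/
theorem tendsto_of_weakStarTendsto {ν : ℕ → ProbabilityMeasure (RN N)}
    {μ : ProbabilityMeasure (RN N)} (h : WeakStarTendsto ν μ) : Tendsto ν atTop (𝓝 μ) := by
  refine tendsto_of_forall_isOpen_le_liminf_nat' fun G hG => ?_
  refine le_of_forall_lt fun r hr => ?_
  obtain ⟨K, hKG, hK, hrK⟩ := hG.exists_lt_isCompact hr
  obtain ⟨f, hf1, hf0, hfc, hf⟩ := exists_continuous_one_zero_of_isCompact hK
    hG.isClosed_compl (Set.disjoint_compl_right_iff_subset.2 hKG)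
  have hfi : ∀ ρ : ProbabilityMeasure (RN N), Integrable f (ρ : Measure (RN N)) := fun ρ =>
    integrable_of_bounds f.continuous.measurable (fun x => (hf x).1) (fun x => (hf x).2) _
  have hlim := ENNReal.tendsto_ofReal (h f f.continuous hfc)
  have e : ∀ ρ : ProbabilityMeasure (RN N), ENNReal.ofReal (∫ x, f x ∂(ρ : Measure (RN N)))
      = ∫⁻ x, ENNReal.ofReal (f x) ∂(ρ : Measure (RN N)) := fun ρ =>
    ofReal_integral_eq_lintegral_ofReal (hfi ρ) (ae_of_all _ fun x => (hf x).1)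
  have hKf : (μ : Measure (RN N)) K ≤ ENNReal.ofReal (∫ x, f x ∂(μ : Measure (RN N))) := by
    rw [e, ← lintegral_indicator_one hK.measurableSet]
    refine lintegral_mono fun x => ?_
    by_cases hx : x ∈ K
    · simp [hx, hf1 hx]
    · simp [hx]
  have hfG : ∀ ρ : ProbabilityMeasure (RN N),
      ENNReal.ofReal (∫ x, f x ∂(ρ : Measure (RN N))) ≤ (ρ : Measure (RN N)) G := fun ρ => by
    rw [e, ← lintegral_indicator_one hG.measurableSet]
    refine lintegral_mono fun x => ?_
    by_cases hx : x ∈ G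
    · simpa [hx] using (hf x).2
    · simp [hx, hf0 (show x ∈ Gᶜ from hx)]
  refine hrK.trans_le (hKf.trans ?_)
  rw [← hlim.liminf_eq]
  exact liminf_le_liminf (Eventually.of_forall fun k => hfG (ν k))

theorem weakStarTendsto_of_tendsto {ν : ℕ → ProbabilityMeasure (RN N)}
    {μ : ProbabilityMeasure (RN N)} (h : Tendsto ν atTop (𝓝 μ)) : WeakStarTendsto ν μ := by
  intro f hf hfc
  obtain ⟨C, hC⟩ := hfc.exists_bound_of_continuous hf
  exact ProbabilityMeasure.tendsto_iff_forall_integral_tendsto.1 h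
    (BoundedContinuousFunction.ofNormedAddCommGroup f hf C hC)

/-! ### Tightness up to translations -/

/-- The translations move the center of a ball of mass at least `2 / 3` to the origin. Every ball of
mass at least `1 - η`, with `η ≤ 1 / 3`, meets this ball, so it lies in a fixed ball around the same
center. -/
theorem exists_isTightMeasureSet_translate {μ : ℕ → ProbabilityMeasure (RN N)}
    (h : ∀ η > 0, ∃ R, ∀ᶠ k in atTop, ∃ x, 1 - η ≤ (μ k : Measure (RN N)).real (Metric.ball x R)) :
    ∃ a : ℕ → RN N, IsTightMeasureSet
      (Set.range fun k => (translateMeasure (a k) (μ k) : Measure (RN N))) := by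
  obtain ⟨R₁, hR₁⟩ := h (1 / 3) (by norm_num)
  obtain ⟨x, hx⟩ := hR₁.choice
  refine ⟨fun k => -x k, isTightMeasureSet_range_of_tendsto_limsup_measure_norm_gt ?_⟩
  refine ENNReal.tendsto_atTop_zero.2 fun ε hε => ?_
  obtain ⟨η, hη0, hη1, hηε⟩ : ∃ η : ℝ, 0 < η ∧ η ≤ 1 / 3 ∧ ENNReal.ofReal η ≤ ε := by
    rcases eq_or_ne ε ⊤ with rfl | hε'
    · exact ⟨1 / 3, by norm_num, le_rfl, le_top⟩
    · refine ⟨min (1 / 3) ε.toReal, lt_min (by norm_num) (ENNReal.toReal_pos hε.ne' hε'),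
        min_le_left _ _, ?_⟩
      exact (ENNReal.ofReal_le_ofReal (min_le_right _ _)).trans (ENNReal.ofReal_toReal hε').le
  obtain ⟨R, hR⟩ := h η hη0
  refine ⟨R₁ + 2 * R, fun r hr => ?_⟩
  refine limsup_le_of_le (by isBoundedDefault) ?_
  filter_upwards [hx, hR] with k hk1 ⟨y, hk2⟩
  refine le_trans ?_ hηε
  -- two disjoint balls would have total mass at least `2 / 3 + (1 - η) ≥ 4 / 3`
  have hmeet : ¬ Disjoint (Metric.ball (x k) R₁) (Metric.ball y R) := fun hd => by
    have h1 := measureReal_union (μ := (μ k : Measure (RN N))) hd Metric.isOpen_ball.measurableSet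
    have h2 : (μ k : Measure (RN N)).real (Metric.ball (x k) R₁ ∪ Metric.ball y R) ≤ 1 :=
      measureReal_le_one
    linarith
  obtain ⟨w, hw1, hw2⟩ := Set.not_disjoint_iff.1 hmeet
  have hm : Measurable fun z : RN N => z + -x k := measurable_add_const _
  have e : (translateMeasure (-x k) (μ k) : Measure (RN N)) {z | r < ‖z‖}
      = (μ k : Measure (RN N)) {z | r < ‖z + -x k‖} :=
    Measure.map_apply hm (measurableSet_lt measurable_const measurable_norm)
  rw [e]
  calc (μ k : Measure (RN N)) {z | r < ‖z + -x k‖}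
      ≤ (μ k : Measure (RN N)) (Metric.ball y R)ᶜ := by
        refine measure_mono fun z hz hzy => ?_
        have hz' : r < dist z (x k) := by
          rw [dist_eq_norm, sub_eq_add_neg]; exact hz
        have h1 : dist z y < R := hzy
        have h2 : dist w y < R := hw2
        have h3 : dist w (x k) < R₁ := hw1
        have h4 := dist_triangle4 z y w (x k)
        rw [dist_comm y w] at h4
        linarith
    _ ≤ ENNReal.ofReal η := by
        rw [← ofReal_measureReal, probReal_compl_eq_one_sub Metric.isOpen_ball.measurableSet]
        exact ENNReal.ofReal_le_ofReal (by linarith)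

theorem weakStarPrecompact_of_isTightMeasureSet {ν : ℕ → ProbabilityMeasure (RN N)}
    (h : IsTightMeasureSet (Set.range fun k => (ν k : Measure (RN N)))) :
    WeakStarPrecompact ν := by
  intro φ _
  have hc : IsCompact (closure (Set.range ν)) :=
    isCompact_closure_of_isTightMeasureSet (by
      refine h.subset ?_
      rintro _ ⟨_, ⟨k, rfl⟩, rfl⟩
      exact ⟨k, rfl⟩)
  obtain ⟨μ, -, ψ, hψ, hlim⟩ := hc.tendsto_subseq
    (x := fun k => ν (φ k)) (fun k => subset_closure ⟨φ k, rfl⟩)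
  exact ⟨ψ, hψ, μ, weakStarTendsto_of_tendsto hlim⟩

/-! ### Asymptotically minimizing sequences concentrate -/

theorem exists_forall_norm_ge_neg_le {g : RN N → EReal}
    (hlim : 0 ≤ liminf g (Bornology.cobounded (RN N))) {ε : ℝ} (hε : 0 < ε) :
    ∃ L : ℝ, 0 ≤ L ∧ ∀ x, L ≤ ‖x‖ → ((-ε : ℝ) : EReal) ≤ g x := by
  have h : ∀ᶠ x in Bornology.cobounded (RN N), ((-ε : ℝ) : EReal) < g x :=
    eventually_lt_of_lt_liminf (lt_of_lt_of_le (by exact_mod_cast neg_lt_zero.2 hε) hlim)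
  obtain ⟨L, -, hL⟩ := hasBasis_cobounded_norm.eventually_iff.1 h
  exact ⟨max L 0, le_max_right _ _, fun x hx => (hL ((le_max_left _ _).trans hx)).le⟩

/-- For an asymptotically minimizing sequence the inner mass `s ≥ δ` of `exists_ball_split` satisfies
`2 |J| s (1 - s) ≤ 2 θ` for a prescribed small `θ`, hence `1 - s ≤ θ / (|J| δ) = η`. -/
theorem exists_ball_of_asymptotically_minimizing {g : RN N → EReal} {C J : ℝ} (hC : 0 < C)
    (hg : ∀ x, ((-C : ℝ) : EReal) ≤ g x) (hlsc : LowerSemicontinuous g)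
    (hlim : 0 ≤ liminf g (Bornology.cobounded (RN N))) (hJ : J < 0)
    (hJ1 : ∀ ε > 0, ∃ M, ∀ ν : ProbabilityMeasure (RN N), J - ε ≤ kernelEnergy (trunc g M) ν)
    {μ : ℕ → ProbabilityMeasure (RN N)}
    (hμ : ∀ M, ∀ ε > 0, ∀ᶠ k in atTop, kernelEnergy (trunc g M) (μ k) ≤ J + ε) {η : ℝ}
    (hη : 0 < η) :
    ∃ R, ∀ᶠ k in atTop, ∃ x, 1 - η ≤ (μ k : Measure (RN N)).real (Metric.ball x R) := by
  -- `δ` makes `-ε - C δ = J / 2` for `ε = |J| / 4`, above the energies `J + κ ≤ 3 J / 4`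
  obtain ⟨δ, hδ⟩ : ∃ δ, δ = -J / (4 * C) := ⟨_, rfl⟩
  have hδ0 : 0 < δ := by rw [hδ]; exact div_pos (by linarith) (by linarith)
  have hCδ : C * δ = -J / 4 := by rw [hδ]; field_simp
  obtain ⟨θ, hθ⟩ : ∃ θ, θ = -J * δ * η := ⟨_, rfl⟩
  have hθ0 : 0 < θ := by rw [hθ]; exact mul_pos (mul_pos (by linarith) hδ0) hη
  obtain ⟨κ, hκ0, hκ1, hκ2⟩ : ∃ κ : ℝ, 0 < κ ∧ κ ≤ θ / 4 ∧ κ ≤ -J / 4 :=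
    ⟨min (θ / 4) (-J / 4), lt_min (by linarith) (by linarith), min_le_left _ _, min_le_right _ _⟩
  obtain ⟨n, hn0, hn⟩ : ∃ n : ℕ, 0 < n ∧ 2 * C / n ≤ θ := by
    obtain ⟨n, hn⟩ := exists_nat_gt (2 * C / θ)
    have hn0 : (0 : ℝ) < n := lt_trans (by positivity) hn
    refine ⟨n, by exact_mod_cast hn0, ?_⟩
    rw [div_lt_iff₀ hθ0] at hn
    rw [div_le_iff₀ hn0]
    linarith
  obtain ⟨M, hM⟩ := hJ1 κ hκ0
  obtain ⟨R, -, hR⟩ := exists_forall_norm_ge_neg_le hlim (ε := -J / 4) (by linarith)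
  obtain ⟨L, hL0, hL⟩ := exists_forall_norm_ge_neg_le hlim (ε := θ / 2) (by linarith)
  have hfm := (lowerSemicontinuous_trunc hg hlsc M).measurable
  have ha : ∀ x, -C ≤ trunc g M x := fun x => le_trunc hg (by linarith) M (hg x)
  have hb := trunc_le hg M
  refine ⟨R + n * L, (hμ M κ hκ0).mono fun k hk => ?_⟩
  obtain ⟨x, hx⟩ := exists_le_measureReal_ball hfm hC.le (ε := -J / 4) (R := R) (δ := δ)
    (by linarith) ha hb (fun x hx => le_trunc hg (by linarith) M (hR x hx)) (μ k)
    (by linarith)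
  obtain ⟨s, hs1, hs2, hs⟩ := exists_ball_split hfm hC.le (ε := θ / 2) (by linarith) hL0
    (i := J - κ) (by linarith) ha hb (fun x hx => le_trunc hg (by linarith) M (hL x hx)) hM
    (μ k) hx hn0
  refine ⟨x, le_trans ?_ hs2⟩
  have hs3 : s ≤ 1 := hs2.trans measureReal_le_one
  have h1 : 2 * (-J) * (s * (1 - s)) ≤ 2 * θ := by
    have : κ * (s ^ 2 + (1 - s) ^ 2) ≤ κ * 1 :=
      mul_le_mul_of_nonneg_left (by nlinarith) hκ0.le
    nlinarith
  have h2 : -J * δ * (1 - s) ≤ -J * δ * η := by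
    have : -J * (δ * (1 - s)) ≤ -J * (s * (1 - s)) :=
      mul_le_mul_of_nonneg_left (mul_le_mul_of_nonneg_right hs1 (by linarith)) (by linarith)
    linarith
  have h3 := le_of_mul_le_mul_left h2 (mul_pos (by linarith) hδ0)
  linarith

/-! ### The extended real valued energy -/

section ext

variable {α : Type*} [MeasurableSpace α]

theorem extIntegral_mono {μ : Measure α} {f g : α → EReal} (h : ∀ x, f x ≤ g x) :
    extIntegral μ f ≤ extIntegral μ g := by
  refine EReal.sub_le_sub ?_ ?_
  · exact EReal.coe_ennreal_le_coe_ennreal_iff.2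
      (lintegral_mono fun x => EReal.toENNReal_le_toENNReal (h x))
  · exact EReal.coe_ennreal_le_coe_ennreal_iff.2
      (lintegral_mono fun x => EReal.toENNReal_le_toENNReal (EReal.neg_le_neg_iff.2 (h x)))

theorem extIntegral_coe {μ : Measure α} {f : α → ℝ} (hf : Integrable f μ) :
    extIntegral μ (fun x => (f x : EReal)) = ((∫ x, f x ∂μ : ℝ) : EReal) := by
  have h1 : ∫⁻ x, ENNReal.ofReal (f x) ∂μ ≠ ⊤ := hf.lintegral_lt_top.ne
  have h2 : ∫⁻ x, ENNReal.ofReal (-f x) ∂μ ≠ ⊤ := hf.neg.lintegral_lt_top.ne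
  rw [integral_eq_lintegral_pos_part_sub_lintegral_neg_part hf, extIntegral]
  simp only [← EReal.coe_neg, EReal.real_coe_toENNReal]
  rw [EReal.coe_sub, EReal.coe_ennreal_toReal h1, EReal.coe_ennreal_toReal h2]

/-- Adding the constant `C` to `f ≥ -C` turns the integral into a single Lebesgue integral of a
nonnegative function, with no subtraction of infinities. -/
theorem extIntegral_eq_shift {μ : Measure α} [IsProbabilityMeasure μ] {f : α → EReal} {C : ℝ}
    (hC : 0 ≤ C) (hf : Measurable f) (hfC : ∀ x, ((-C : ℝ) : EReal) ≤ f x) :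
    extIntegral μ f = ((∫⁻ x, (f x + C).toENNReal ∂μ : ℝ≥0∞) : EReal) - (C : EReal) := by
  have hpt : ∀ x, (f x + C).toENNReal + (-f x).toENNReal
      = (f x).toENNReal + ENNReal.ofReal C := by
    intro x
    have hx := hfC x
    induction h : f x using EReal.rec with
    | bot => rw [h] at hx; simp at hx
    | top => simp
    | coe r =>
      rw [h] at hx
      have hr : -C ≤ r := by exact_mod_cast hx
      rw [← EReal.coe_add, ← EReal.coe_neg]
      simp only [EReal.real_coe_toENNReal]
      rcases le_total 0 r with h0 | h0
      · rw [ENNReal.ofReal_of_nonpos (neg_nonpos.2 h0), add_zero, ENNReal.ofReal_add h0 hC]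
      · rw [ENNReal.ofReal_of_nonpos h0, zero_add,
          ← ENNReal.ofReal_add (by linarith) (neg_nonneg.2 h0)]
        congr 1; ring
  have hint : ∫⁻ x, (f x + C).toENNReal ∂μ + ∫⁻ x, (-f x).toENNReal ∂μ
      = ∫⁻ x, (f x).toENNReal ∂μ + ENNReal.ofReal C := by
    have hm : Measurable fun x => (-f x).toENNReal := hf.neg.ereal_toENNReal
    rw [← lintegral_add_right _ hm]
    simp only [hpt]
    rw [lintegral_add_right _ measurable_const]
    simp
  have hN : ∫⁻ x, (-f x).toENNReal ∂μ ≠ ⊤ := by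
    refine ne_top_of_le_ne_top (ENNReal.ofReal_ne_top (r := C)) ?_
    calc ∫⁻ x, (-f x).toENNReal ∂μ ≤ ∫⁻ _, ENNReal.ofReal C ∂μ := lintegral_mono fun x => by
          rw [← EReal.real_coe_toENNReal]
          refine EReal.toENNReal_le_toENNReal (EReal.neg_le.2 ?_)
          exact_mod_cast hfC x
      _ = _ := by simp
  rw [extIntegral]
  generalize ∫⁻ x, (f x + C).toENNReal ∂μ = K at *
  generalize ∫⁻ x, (f x).toENNReal ∂μ = P at *
  generalize ∫⁻ x, (-f x).toENNReal ∂μ = Q at *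
  lift Q to NNReal using hN
  rcases eq_or_ne P ⊤ with rfl | hP
  · have hK : K = ⊤ := by
      by_contra hK
      rw [top_add] at hint
      exact (ENNReal.add_ne_top.2 ⟨hK, ENNReal.coe_ne_top⟩) hint
    rw [hK]
    rfl
  · have hK : K ≠ ⊤ := by
      rintro rfl
      rw [top_add] at hint
      exact (ENNReal.add_ne_top.2 ⟨hP, ENNReal.ofReal_ne_top⟩) hint.symm
    lift K to NNReal using hK
    lift P to NNReal using hP
    have h := congrArg ENNReal.toReal hint
    rw [ENNReal.toReal_add ENNReal.coe_ne_top ENNReal.coe_ne_top,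
      ENNReal.toReal_add ENNReal.coe_ne_top ENNReal.ofReal_ne_top, ENNReal.toReal_ofReal hC] at h
    simp only [ENNReal.coe_toReal] at h
    have h' : (P : ℝ) - Q = K - C := by linarith
    simp only [EReal.coe_nnreal_eq_coe_real, ← EReal.coe_sub]
    exact congrArg _ h'

end ext

theorem kernelEnergy_trunc_le_energy {g : RN N → EReal} {C : ℝ}
    (hg : ∀ x, ((-C : ℝ) : EReal) ≤ g x) (hlsc : LowerSemicontinuous g) (hC : 0 ≤ C) (M : ℕ)
    (μ : ProbabilityMeasure (RN N)) : (kernelEnergy (trunc g M) μ : EReal) ≤ energy g μ := by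
  rw [kernelEnergy, ← extIntegral_coe (integrable_kernel
    (lowerSemicontinuous_trunc hg hlsc M).measurable
    (fun x => le_trunc hg (neg_nonpos.2 hC) M (hg x)) (trunc_le hg M) _)]
  exact extIntegral_mono fun p => coe_trunc_le hg M _

/-- Monotone convergence as the truncation level tends to infinity. -/
theorem energy_le_of_forall_kernelEnergy_trunc_le {g : RN N → EReal} {C J : ℝ}
    (hg : ∀ x, ((-C : ℝ) : EReal) ≤ g x) (hlsc : LowerSemicontinuous g) (hC : 0 ≤ C)
    {μ : ProbabilityMeasure (RN N)} (h : ∀ M, kernelEnergy (trunc g M) μ ≤ J) :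
    energy g μ ≤ J := by
  have ha : ∀ M x, -C ≤ trunc g M x := fun M x => le_trunc hg (neg_nonpos.2 hC) M (hg x)
  have hm : ∀ M, Measurable (trunc g M) := fun M => (lowerSemicontinuous_trunc hg hlsc M).measurable
  have hJ : 0 ≤ J + C := by
    have := (le_kernelEnergy (hm 0) (ha 0) (trunc_le hg 0) μ).trans (h 0)
    linarith
  have hsup : ∀ x, (g x + C).toENNReal ≤ ⨆ M, ENNReal.ofReal (trunc g M x + C) := by
    intro x
    have hx := hg x
    have ht := fun M => coe_trunc hg M x
    induction hgx : g x using EReal.rec with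
    | bot => rw [hgx] at hx; simp at hx
    | top =>
      refine le_of_eq (Eq.symm ?_)
      simp only [hgx, le_top, inf_of_le_right, EReal.coe_eq_coe_iff] at ht
      simp only [ht, EReal.top_add_coe, EReal.toENNReal_top]
      refine ENNReal.eq_top_of_forall_nnreal_le fun r => ?_
      obtain ⟨M, hM⟩ := exists_nat_ge (r : ℝ)
      refine le_iSup_of_le M ?_
      rw [← ENNReal.ofReal_coe_nnreal]
      exact ENNReal.ofReal_le_ofReal (by linarith)
    | coe r =>
      obtain ⟨M, hM⟩ := exists_nat_ge r
      refine le_iSup_of_le M ?_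
      have := ht M
      rw [hgx, min_eq_left (by exact_mod_cast hM)] at this
      rw [EReal.coe_eq_coe_iff.1 this]
      exact le_rfl
  have hgm : Measurable fun p : RN N × RN N => g (p.1 - p.2) :=
    hlsc.measurable.comp (measurable_fst.sub measurable_snd)
  have hK : ∫⁻ p, (g (p.1 - p.2) + C).toENNReal ∂((μ : Measure (RN N)).prod μ)
      ≤ ENNReal.ofReal (J + C) := by
    have hle : ∀ p : RN N × RN N, (g (p.1 - p.2) + C).toENNReal
        ≤ ⨆ M, ENNReal.ofReal (trunc g M (p.1 - p.2) + C) := fun p => hsup _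
    refine (lintegral_mono hle).trans ?_
    have hs : ∀ M, Measurable fun p : RN N × RN N => ENNReal.ofReal (trunc g M (p.1 - p.2) + C) :=
      fun M => (((hm M).comp (measurable_fst.sub measurable_snd)).add_const C).ennreal_ofReal
    have hmono : Monotone fun (M : ℕ) (p : RN N × RN N) =>
        ENNReal.ofReal (trunc g M (p.1 - p.2) + C) := by
      intro M M' hMM p
      have := trunc_mono hg hMM (p.1 - p.2)
      exact ENNReal.ofReal_le_ofReal (by linarith)
    rw [lintegral_iSup hs hmono]
    refine iSup_le fun M => ?_
    rw [← ofReal_kernelEnergy_add (hm M) (ha M) (trunc_le hg M)]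
    exact ENNReal.ofReal_le_ofReal (by linarith [h M])
  rw [energy, extIntegral_eq_shift hC hgm fun p => hg _]
  refine EReal.sub_le_of_le_add ?_
  refine (EReal.coe_ennreal_le_coe_ennreal_iff.2 hK).trans ?_
  rw [EReal.coe_ennreal_ofReal, max_eq_left hJ, EReal.coe_add]

/-! ### Discrete energies -/

theorem EReal.coe_sum_real {ι : Type*} (s : Finset ι) (f : ι → ℝ) :
    ((∑ i ∈ s, f i : ℝ) : EReal) = ∑ i ∈ s, (f i : EReal) := by
  classical
  induction s using Finset.induction_on with
  | empty => simp
  | insert i s hi ih => rw [Finset.sum_insert hi, Finset.sum_insert hi, EReal.coe_add, ih]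

theorem EReal.coe_sum_ennreal {ι : Type*} (s : Finset ι) (f : ι → ℝ≥0∞) :
    ((∑ i ∈ s, f i : ℝ≥0∞) : EReal) = ∑ i ∈ s, (f i : EReal) := by
  classical
  induction s using Finset.induction_on with
  | empty => simp
  | insert i s hi ih => rw [Finset.sum_insert hi, Finset.sum_insert hi, EReal.coe_ennreal_add, ih]

theorem isProbabilityMeasure_empiricalMeasure {n : ℕ} (hn : 0 < n) (x : Fin n → RN N) :
    IsProbabilityMeasure (empiricalMeasure x) := by
  constructor
  simp only [empiricalMeasure, Measure.smul_apply, Measure.finsetSum_apply, measure_univ,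
    Finset.sum_const, Finset.card_univ, Fintype.card_fin, smul_eq_mul, nsmul_eq_mul, mul_one]
  exact ENNReal.inv_mul_cancel (by exact_mod_cast hn.ne') (ENNReal.natCast_ne_top n)

theorem integral_empiricalMeasure {f : RN N → ℝ} {a b : ℝ} (hf : Measurable f)
    (ha : ∀ x, a ≤ f x) (hb : ∀ x, f x ≤ b) {n : ℕ} (x : Fin n → RN N) :
    ∫ y, f y ∂(empiricalMeasure x) = (n : ℝ)⁻¹ * ∑ i, f (x i) := by
  rw [empiricalMeasure, integral_smul_measure,
    integral_finsetSum_measure fun i _ => integrable_of_bounds hf ha hb _]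
  simp

theorem kernelEnergy_empiricalMeasure {f : RN N → ℝ} {a b : ℝ} (hf : Measurable f)
    (ha : ∀ x, a ≤ f x) (hb : ∀ x, f x ≤ b) {n : ℕ} (hn : 0 < n) (x : Fin n → RN N) :
    kernelEnergy f (empiricalMeasure x) = 1 / (n : ℝ) ^ 2 * ∑ i, ∑ j, f (x i - x j) := by
  have := isProbabilityMeasure_empiricalMeasure hn x
  have hn' : (0 : ℝ) < n := by exact_mod_cast hn
  rw [kernelEnergy, integral_prod _ (integrable_kernel hf ha hb _)]
  have h1 : ∀ y, ∫ z, f (y - z) ∂(empiricalMeasure x) = (n : ℝ)⁻¹ * ∑ j, f (y - x j) := fun y =>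
    integral_empiricalMeasure (f := fun z => f (y - z)) (hf.comp (measurable_const_sub y))
      (fun _ => ha _) (fun _ => hb _) x
  simp only [h1]
  have hi : ∀ j ∈ Finset.univ, Integrable (fun y => f (y - x j)) (empiricalMeasure x) := fun j _ =>
    integrable_of_bounds (hf.comp (measurable_sub_const (x j))) (fun _ => ha _) (fun _ => hb _) _
  rw [integral_const_mul, integral_finsetSum _ hi]
  have h2 : ∀ j, ∫ y, f (y - x j) ∂(empiricalMeasure x) = (n : ℝ)⁻¹ * ∑ i, f (x i - x j) :=
    fun j => integral_empiricalMeasure (f := fun y => f (y - x j))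
      (hf.comp (measurable_sub_const (x j))) (fun _ => ha _) (fun _ => hb _) x
  simp only [h2]
  rw [← Finset.mul_sum, Finset.sum_comm]
  field_simp

/-- The particle energy omits the diagonal, which contributes at most `M / n` to the truncated energy
of the empirical measure. -/
theorem kernelEnergy_trunc_sub_le_particleEnergy {g : RN N → EReal} {C : ℝ}
    (hg : ∀ x, ((-C : ℝ) : EReal) ≤ g x) (hlsc : LowerSemicontinuous g) (hC : 0 ≤ C) (M : ℕ)
    {n : ℕ} (hn : 0 < n) (x : Fin n → RN N) :
    ((kernelEnergy (trunc g M) (empiricalMeasure x) - M / n : ℝ) : EReal)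
      ≤ particleEnergy g x := by
  classical
  have hn' : (0 : ℝ) < n := by exact_mod_cast hn
  rw [kernelEnergy_empiricalMeasure (lowerSemicontinuous_trunc hg hlsc M).measurable
    (fun x => le_trunc hg (neg_nonpos.2 hC) M (hg x)) (trunc_le hg M) hn]
  have hsum : ∑ i, ∑ j, trunc g M (x i - x j)
      ≤ ∑ p ∈ (Finset.univ : Finset (Fin n)).offDiag, trunc g M (x p.1 - x p.2) + n * M := by
    rw [← Finset.sum_product', ← Finset.diag_union_offDiag,
      Finset.sum_union (Finset.disjoint_diag_offDiag _), add_comm]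
    gcongr
    refine (Finset.sum_le_card_nsmul _ _ (M : ℝ) fun p _ => trunc_le hg M _).trans ?_
    simp [Finset.diag_card]
  calc ((1 / (n : ℝ) ^ 2 * ∑ i, ∑ j, trunc g M (x i - x j) - M / n : ℝ) : EReal)
      ≤ ((1 / (n : ℝ) ^ 2 * ∑ p ∈ (Finset.univ : Finset (Fin n)).offDiag,
          trunc g M (x p.1 - x p.2) : ℝ) : EReal) := by
        refine EReal.coe_le_coe_iff.2 ?_
        have h1 := mul_le_mul_of_nonneg_left hsum (show 0 ≤ 1 / (n : ℝ) ^ 2 by positivity)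
        have h2 : 1 / (n : ℝ) ^ 2 * (n * M) = M / n := by field_simp
        rw [mul_add, h2] at h1
        linarith
    _ ≤ particleEnergy g x := by
        rw [EReal.coe_mul, EReal.coe_sum_real, particleEnergy]
        refine mul_le_mul_of_nonneg_left (Finset.sum_le_sum fun p _ => coe_trunc_le hg M _) ?_
        exact_mod_cast (show 0 ≤ 1 / (n : ℝ) ^ 2 by positivity)

theorem kernelEnergy_trunc_sub_le_discreteEnergy {g : RN N → EReal} {C : ℝ}
    (hg : ∀ x, ((-C : ℝ) : EReal) ≤ g x) (hlsc : LowerSemicontinuous g) (hC : 0 ≤ C) (M n : ℕ)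
    (μ : ProbabilityMeasure (RN N)) :
    ((kernelEnergy (trunc g M) μ - M / n : ℝ) : EReal) ≤ discreteEnergy g n μ := by
  refine le_iInf₂ fun x hx => ?_
  rcases Nat.eq_zero_or_pos n with rfl | hn
  · -- the empirical measure of no points is zero
    have h1 : (μ : Measure (RN N)) Set.univ = 1 := measure_univ
    rw [hx] at h1
    simp [empiricalMeasure] at h1
  · rw [hx]
    exact kernelEnergy_trunc_sub_le_particleEnergy hg hlsc hC M hn x

theorem map_pi_eval_prod (μ : Measure (RN N)) [IsProbabilityMeasure μ] {n : ℕ} {i j : Fin n}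
    (hij : i ≠ j) :
    (Measure.pi fun _ : Fin n => μ).map (fun x => (x i, x j)) = μ.prod μ := by
  have hind := ProbabilityTheory.iIndepFun_pi (μ := fun _ : Fin n => μ)
    (X := fun _ => (id : RN N → RN N)) (fun _ => aemeasurable_id)
  have h := (ProbabilityTheory.indepFun_iff_map_prod_eq_prod_map_map
    (measurable_pi_apply i).aemeasurable (measurable_pi_apply j).aemeasurable).1
    (hind.indepFun hij)
  rw [(measurePreserving_eval (fun _ : Fin n => μ) i).map_eq,
    (measurePreserving_eval (fun _ : Fin n => μ) j).map_eq] at h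
  exact h

theorem groundEnergy_le_particleEnergy (g : RN N → EReal) {n : ℕ} (hn : 0 < n)
    (x : Fin n → RN N) : groundEnergy g n ≤ particleEnergy g x := by
  let μ : ProbabilityMeasure (RN N) :=
    ⟨empiricalMeasure x, isProbabilityMeasure_empiricalMeasure hn x⟩
  have hμ : (μ : Measure (RN N)) = empiricalMeasure x := rfl
  have h : discreteEnergy g n μ ≤ particleEnergy g x := iInf₂_le x hμ
  exact (iInf_le _ μ).trans h

/-- `n` independent points with law `μ` have mean energy `(1 - 1 / n) 𝓔 μ`, so some configuration of `n`
points does at least as well. -/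
theorem groundEnergy_le {g : RN N → EReal} {C : ℝ} (hC : 0 ≤ C)
    (hg : ∀ x, ((-C : ℝ) : EReal) ≤ g x) (hlsc : LowerSemicontinuous g) {n : ℕ} (hn : 0 < n)
    {μ : ProbabilityMeasure (RN N)} {e : ℝ} (he : energy g μ ≤ e) :
    groundEnergy g n ≤ (((1 - 1 / n) * e : ℝ) : EReal) := by
  have hn' : (0 : ℝ) < n := by exact_mod_cast hn
  have hgm : Measurable fun p : RN N × RN N => g (p.1 - p.2) :=
    hlsc.measurable.comp (measurable_fst.sub measurable_snd)
  -- the average is taken of the nonnegative kernel `g + C`, as a Lebesgue integral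
  set h : RN N → ℝ≥0∞ := fun z => (g z + C).toENNReal with hh
  have hhm : Measurable fun p : RN N × RN N => h (p.1 - p.2) :=
    (hgm.add measurable_const).ereal_toENNReal
  have hcoe : ∀ z, (h z : EReal) = g z + C := fun z => by
    refine EReal.coe_toENNReal ?_
    have := add_le_add_left (hg z) (C : EReal)
    rwa [← EReal.coe_add, neg_add_cancel, EReal.coe_zero] at this
  set K := ∫⁻ p, h (p.1 - p.2) ∂((μ : Measure (RN N)).prod μ) with hKdef
  have hK : (K : EReal) ≤ ((e + C : ℝ) : EReal) := by
    rw [energy, extIntegral_eq_shift hC hgm fun p => hg _] at he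
    rw [EReal.coe_add]
    exact (EReal.sub_le_iff_le_add (Or.inl (EReal.coe_ne_bot _))
      (Or.inl (EReal.coe_ne_top _))).1 he
  set s := (Finset.univ : Finset (Fin n)).offDiag with hs
  have hcard : (s.card : ℝ) = n * n - n := by
    rw [hs, Finset.offDiag_card, Finset.card_univ, Fintype.card_fin,
      Nat.cast_sub (Nat.le_mul_self n), Nat.cast_mul]
  have hterm : ∀ p ∈ s, ∫⁻ x, h (x p.1 - x p.2) ∂(Measure.pi fun _ : Fin n => (μ : Measure (RN N)))
      = K := fun p hp => by
    rw [hKdef, ← map_pi_eval_prod (μ : Measure (RN N)) (Finset.mem_offDiag.1 hp).2.2,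
      lintegral_map hhm ((measurable_pi_apply p.1).prodMk (measurable_pi_apply p.2))]
  have hmeas : ∀ p ∈ s, Measurable fun x : Fin n → RN N => h (x p.1 - x p.2) := fun p _ => by
    have hp : Measurable fun x : Fin n → RN N => (x p.1, x p.2) :=
      (measurable_pi_apply p.1).prodMk (measurable_pi_apply p.2)
    exact hhm.comp hp
  obtain ⟨x, hx⟩ := exists_le_lintegral
    (μ := Measure.pi fun _ : Fin n => (μ : Measure (RN N)))
    (f := fun x => ∑ p ∈ s, h (x p.1 - x p.2)) (Finset.measurable_fun_sum s hmeas).aemeasurable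
  rw [lintegral_finsetSum s hmeas, Finset.sum_congr rfl hterm] at hx
  have hx' := EReal.coe_ennreal_le_coe_ennreal_iff.2 hx
  have hsum : ∑ p ∈ s, g (x p.1 - x p.2) ≤ ((s.card * e : ℝ) : EReal) := by
    rw [EReal.coe_sum_ennreal, EReal.coe_sum_ennreal] at hx'
    simp only [hcoe] at hx'
    rw [Finset.sum_add_distrib, ← EReal.coe_sum_real] at hx'
    have h2 := hx'.trans (Finset.sum_le_sum fun _ _ => hK)
    rw [← EReal.coe_sum_real, ← EReal.le_sub_iff_add_le (Or.inl (EReal.coe_ne_bot _))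
      (Or.inl (EReal.coe_ne_top _)), ← EReal.coe_sub] at h2
    refine h2.trans (le_of_eq ?_)
    congr 1
    simp only [Finset.sum_const, nsmul_eq_mul]
    ring
  refine (groundEnergy_le_particleEnergy g hn x).trans ?_
  refine (mul_le_mul_of_nonneg_left hsum ?_).trans (le_of_eq ?_)
  · exact_mod_cast (show 0 ≤ 1 / (n : ℝ) ^ 2 by positivity)
  · rw [← EReal.coe_mul, hcard]
    congr 1
    field_simp

/-! ### Minimizers of the continuum energy and convergence of ground states -/

theorem exists_weakStarPrecompact_translate {g : RN N → EReal} {C J : ℝ} (hC : 0 < C)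
    (hg : ∀ x, ((-C : ℝ) : EReal) ≤ g x) (hlsc : LowerSemicontinuous g)
    (hlim : 0 ≤ liminf g (Bornology.cobounded (RN N))) (hJ : J < 0)
    (hJ1 : ∀ ε > 0, ∃ M, ∀ ν : ProbabilityMeasure (RN N), J - ε ≤ kernelEnergy (trunc g M) ν)
    {μ : ℕ → ProbabilityMeasure (RN N)}
    (hμ : ∀ M, ∀ ε > 0, ∀ᶠ k in atTop, kernelEnergy (trunc g M) (μ k) ≤ J + ε) :
    ∃ a : ℕ → RN N, WeakStarPrecompact fun k => translateMeasure (a k) (μ k) := by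
  obtain ⟨a, ha⟩ := exists_isTightMeasureSet_translate fun η hη =>
    exists_ball_of_asymptotically_minimizing hC hg hlsc hlim hJ hJ1 hμ hη
  exact ⟨a, weakStarPrecompact_of_isTightMeasureSet ha⟩

theorem energy_le_of_isWeakStarLimitPoint {g : RN N → EReal} {C J : ℝ} (hC : 0 ≤ C)
    (hg : ∀ x, ((-C : ℝ) : EReal) ≤ g x) (hlsc : LowerSemicontinuous g)
    {μ : ℕ → ProbabilityMeasure (RN N)}
    (hμ : ∀ M, ∀ ε > 0, ∀ᶠ k in atTop, kernelEnergy (trunc g M) (μ k) ≤ J + ε)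
    {a : ℕ → RN N} {ν : ProbabilityMeasure (RN N)}
    (hν : IsWeakStarLimitPoint (fun k => translateMeasure (a k) (μ k)) ν) : energy g ν ≤ J := by
  obtain ⟨φ, hφ, hlim⟩ := hν
  refine energy_le_of_forall_kernelEnergy_trunc_le hg hlsc hC fun M => ?_
  have hM := lowerSemicontinuous_trunc hg hlsc M
  refine kernelEnergy_le_of_tendsto hM (fun x => le_trunc hg (neg_nonpos.2 hC) M (hg x))
    (trunc_le hg M) (tendsto_of_weakStarTendsto hlim) fun ε hε => ?_
  filter_upwards [hφ.tendsto_atTop.eventually (hμ M ε hε)] with k hk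
  exact (kernelEnergy_map_add hM.measurable (μ (φ k) : Measure (RN N)) (a (φ k))).trans_le hk

/-- The infimum of the energy is a negative number, is attained, and is the supremum of the infima of
the truncated energies. -/
theorem exists_energy_eq_iInf {g : RN N → EReal} {C : ℝ} (hC : 0 < C)
    (hg : ∀ x, ((-C : ℝ) : EReal) ≤ g x) (hlsc : LowerSemicontinuous g)
    (hlim : 0 ≤ liminf g (Bornology.cobounded (RN N)))
    (hneg : ∃ μ₀ : ProbabilityMeasure (RN N), energy g μ₀ < 0) :
    ∃ J : ℝ, J < 0 ∧ (⨅ μ : ProbabilityMeasure (RN N), energy g μ) = J ∧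
      (∃ μ : ProbabilityMeasure (RN N), energy g μ ≤ J) ∧
      ∀ ε > 0, ∃ M, ∀ ν : ProbabilityMeasure (RN N), J - ε ≤ kernelEnergy (trunc g M) ν := by
  obtain ⟨μ₀, hμ₀⟩ := hneg
  have : Nonempty (ProbabilityMeasure (RN N)) := ⟨μ₀⟩
  obtain ⟨e, he1, he2⟩ := EReal.lt_iff_exists_real_btwn.1 hμ₀
  have he0 : e < 0 := by exact_mod_cast he2
  have ha : ∀ M x, -C ≤ trunc g M x := fun M x => le_trunc hg (neg_nonpos.2 hC.le) M (hg x)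
  have hm : ∀ M, Measurable (trunc g M) := fun M => (lowerSemicontinuous_trunc hg hlsc M).measurable
  set I : ℕ → ℝ := fun M => ⨅ ν : ProbabilityMeasure (RN N), kernelEnergy (trunc g M) ν with hI
  have hbdd : ∀ M, BddBelow (Set.range fun ν : ProbabilityMeasure (RN N) =>
      kernelEnergy (trunc g M) ν) := fun M =>
    ⟨-C, by rintro _ ⟨ν, rfl⟩; exact le_kernelEnergy (hm M) (ha M) (trunc_le hg M) ν⟩
  have hIle : ∀ M (ν : ProbabilityMeasure (RN N)), I M ≤ kernelEnergy (trunc g M) ν :=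
    fun M ν => ciInf_le (hbdd M) ν
  have hIen : ∀ {ν : ProbabilityMeasure (RN N)} {r : ℝ}, energy g ν ≤ r → ∀ M, I M ≤ r :=
    fun {ν r} h M => (hIle M ν).trans (EReal.coe_le_coe_iff.1
      ((kernelEnergy_trunc_le_energy hg hlsc hC.le M ν).trans h))
  have hIbdd : BddAbove (Set.range I) := ⟨e, by rintro _ ⟨M, rfl⟩; exact hIen he1.le M⟩
  set J : ℝ := ⨆ M, I M with hJdef
  have hJ0 : J < 0 := (ciSup_le fun M => hIen he1.le M).trans_lt he0
  have hJ1 : ∀ ε > 0, ∃ M, ∀ ν : ProbabilityMeasure (RN N),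
      J - ε ≤ kernelEnergy (trunc g M) ν := fun ε hε => by
    obtain ⟨M, hM⟩ := exists_lt_of_lt_ciSup (show J - ε < ⨆ M, I M by linarith)
    exact ⟨M, fun ν => hM.le.trans (hIle M ν)⟩
  have hle : ∀ ν : ProbabilityMeasure (RN N), (J : EReal) ≤ energy g ν := fun ν => by
    by_contra! h
    obtain ⟨r, hr1, hr2⟩ := EReal.lt_iff_exists_real_btwn.1 h
    exact (EReal.coe_lt_coe_iff.1 hr2).not_ge (ciSup_le fun M => hIen hr1.le M)
  -- almost minimizers at truncation level `k` are asymptotically minimizing, as `trunc g M` increases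
  -- with `M`
  have hex : ∀ k : ℕ, ∃ ν : ProbabilityMeasure (RN N),
      kernelEnergy (trunc g k) ν < I k + 1 / ((k : ℝ) + 1) := fun k =>
    exists_lt_of_ciInf_lt (lt_add_of_pos_right _ (by positivity))
  choose μ hμ using hex
  have hasymp : ∀ M, ∀ ε > 0, ∀ᶠ k in atTop, kernelEnergy (trunc g M) (μ k) ≤ J + ε := by
    intro M ε hε
    filter_upwards [eventually_ge_atTop M,
      (tendsto_one_div_add_atTop_nhds_zero_nat (𝕜 := ℝ)).eventually (eventually_le_nhds hε)]
      with k hk1 hk2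
    have h1 := kernelEnergy_mono (hm M) (ha M) (trunc_le hg M) (hm k) (ha k) (trunc_le hg k)
      (trunc_mono hg hk1) (μ k)
    have h2 : I k ≤ J := le_ciSup hIbdd k
    linarith [hμ k]
  obtain ⟨a, hpre⟩ := exists_weakStarPrecompact_translate hC hg hlsc hlim hJ0 hJ1 hasymp
  obtain ⟨ψ, hψ, ν, hν⟩ := hpre id strictMono_id
  have hνJ : energy g ν ≤ J :=
    energy_le_of_isWeakStarLimitPoint hC.le hg hlsc hasymp (a := a) ⟨ψ, hψ, hν⟩
  exact ⟨J, hJ0, le_antisymm ((iInf_le _ ν).trans hνJ) (le_iInf hle), ⟨ν, hνJ⟩, hJ1⟩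

theorem tendsto_groundEnergy {g : RN N → EReal} {C J : ℝ} (hC : 0 ≤ C)
    (hg : ∀ x, ((-C : ℝ) : EReal) ≤ g x) (hlsc : LowerSemicontinuous g)
    (hmin : ∃ μ : ProbabilityMeasure (RN N), energy g μ ≤ J)
    (hJ1 : ∀ ε > 0, ∃ M, ∀ ν : ProbabilityMeasure (RN N), J - ε ≤ kernelEnergy (trunc g M) ν) :
    Tendsto (fun n => groundEnergy g n) atTop (𝓝 (J : EReal)) := by
  refine tendsto_order.2 ⟨fun b hb => ?_, fun b hb => ?_⟩
  · obtain ⟨r, hr1, hr2⟩ := EReal.lt_iff_exists_real_btwn.1 hb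
    have hr : r < J := EReal.coe_lt_coe_iff.1 hr2
    obtain ⟨M, hM⟩ := hJ1 ((J - r) / 2) (by linarith)
    filter_upwards [(tendsto_const_div_atTop_nhds_zero_nat (M : ℝ)).eventually
      (eventually_le_nhds (show 0 < (J - r) / 2 by linarith))] with n hn
    refine hr1.trans_le (le_iInf fun ν => ?_)
    refine le_trans ?_ (kernelEnergy_trunc_sub_le_discreteEnergy hg hlsc hC M n ν)
    exact EReal.coe_le_coe_iff.2 (by linarith [hM ν])
  · obtain ⟨μ, hμ⟩ := hmin
    have hlim : Tendsto (fun n : ℕ => (((1 - 1 / (n : ℝ)) * J : ℝ) : EReal)) atTop (𝓝 J) := by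
      refine (continuous_coe_real_ereal.tendsto J).comp ?_
      simpa using ((tendsto_const_nhds (x := (1 : ℝ))).sub
        tendsto_one_div_atTop_nhds_zero_nat).mul_const J
    filter_upwards [hlim.eventually (eventually_lt_nhds hb), eventually_gt_atTop 0] with n hn hn0
    exact (groundEnergy_le hC hg hlsc hn0 hμ).trans_lt hn

/-- Discrete measures whose energies tend to `J` are asymptotically minimizing for the truncated
continuum energies. -/
theorem eventually_kernelEnergy_trunc_le {g : RN N → EReal} {C J : ℝ} (hC : 0 ≤ C)
    (hg : ∀ x, ((-C : ℝ) : EReal) ≤ g x) (hlsc : LowerSemicontinuous g) {n : ℕ → ℕ}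
    (hn : StrictMono n) {π : ℕ → ProbabilityMeasure (RN N)}
    (hπ : Tendsto (fun k => discreteEnergy g (n k) (π k)) atTop (𝓝 (J : EReal))) (M : ℕ)
    {ε : ℝ} (hε : 0 < ε) : ∀ᶠ k in atTop, kernelEnergy (trunc g M) (π k) ≤ J + ε := by
  have hJε : (J : EReal) < ((J + ε / 2 : ℝ) : EReal) := EReal.coe_lt_coe_iff.2 (by linarith)
  filter_upwards [hπ.eventually (eventually_lt_nhds hJε),
    ((tendsto_const_div_atTop_nhds_zero_nat (M : ℝ)).comp hn.tendsto_atTop).eventually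
      (eventually_le_nhds (half_pos hε))] with k hk1 hk2
  have h := EReal.coe_lt_coe_iff.1
    ((kernelEnergy_trunc_sub_le_discreteEnergy hg hlsc hC M (n k) (π k)).trans_lt hk1)
  simp only [Function.comp_apply] at hk2
  linarith

theorem mainTheorem2 (N : ℕ) (g : RN N → EReal)
    -- (H1): `g` is bounded from below, lower semicontinuous and locally integrable
    (hbdd : ∃ c : ℝ, ∀ x, (c : EReal) ≤ g x)
    (hlsc : LowerSemicontinuous g)
    (hfin : ∀ᵐ x ∂(volume : Measure (RN N)), g x ≠ ⊤)
    (hloc : LocallyIntegrable (fun x => (g x).toReal) (volume : Measure (RN N)))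
    -- (H2): the lower limit of `g` at infinity is nonnegative
    (hlim : 0 ≤ liminf g (Bornology.cobounded (RN N)))
    -- (H4): some probability measure has negative energy
    (hneg : ∃ μ₀ : ProbabilityMeasure (RN N), energy g μ₀ < 0) :
    liminf (fun n => groundEnergy g n) atTop = (⨅ μ : ProbabilityMeasure (RN N), energy g μ) ∧
    Tendsto (fun n => groundEnergy g n) atTop
      (𝓝 (⨅ μ : ProbabilityMeasure (RN N), energy g μ)) ∧
    -- `n` is the sequence of particle numbers; the whole sequence is the case `n k = k`
    ∀ n : ℕ → ℕ, StrictMono n → ∀ π : ℕ → ProbabilityMeasure (RN N),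
      Tendsto (fun k => discreteEnergy g (n k) (π k)) atTop
        (𝓝 (liminf (fun n => groundEnergy g n) atTop)) →
      (∃ a : ℕ → RN N, WeakStarPrecompact (fun k => translateMeasure (a k) (π k))) ∧
      (∀ (a : ℕ → RN N) (μ : ProbabilityMeasure (RN N)),
        IsWeakStarLimitPoint (fun k => translateMeasure (a k) (π k)) μ → IsEnergyMinimizer g μ) := by
  obtain ⟨c, hc⟩ := hbdd
  obtain ⟨C, hC, hg⟩ : ∃ C : ℝ, 0 < C ∧ ∀ x, ((-C : ℝ) : EReal) ≤ g x :=
    ⟨max 1 (-c), lt_max_of_lt_left one_pos, fun x =>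
      le_trans (EReal.coe_le_coe_iff.2 (neg_le.1 (le_max_right 1 (-c)))) (hc x)⟩
  obtain ⟨J, hJ0, hJ, hmin, hJ1⟩ := exists_energy_eq_iInf hC hg hlsc hlim hneg
  have htend := tendsto_groundEnergy hC.le hg hlsc hmin hJ1
  rw [hJ, htend.liminf_eq]
  refine ⟨rfl, htend, fun n hn π hπ => ?_⟩
  have hasymp : ∀ M, ∀ ε > 0, ∀ᶠ k in atTop, kernelEnergy (trunc g M) (π k) ≤ J + ε :=
    fun M _ hε => eventually_kernelEnergy_trunc_le hC.le hg hlsc hn hπ M hε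
  refine ⟨exists_weakStarPrecompact_translate hC hg hlsc hlim hJ0 hJ1 hasymp, fun a μ hμ ν => ?_⟩
  exact (energy_le_of_isWeakStarLimitPoint hC.le hg hlsc hasymp hμ).trans
    (hJ ▸ iInf_le (fun μ => energy g μ) ν)
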